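/- For $n\in\mathbb{N}_0$ and $\alpha\in\mathbb{C}$ let $P_n(\alpha)=(-1)^n\binom{\alpha}{n}=\frac{(-1)^n}{n!}\prod_{m=0}^{n-1}(\alpha-m)$. Let $\zeta$ be the Riemann zeta function (meromorphically continued to $\mathbb{C}$) and let $\eta(s)=(1-2^{1-s})\zeta(s)$ for $s\ne 1$, with $\eta(1)=\lim_{s\to1}(1-2^{1-s})\zeta(s)=\log 2$. Then: 1. for every $s\in\mathbb{C}$ with $\operatorname{Re}s>0$, $\eta$ is the Dirichlet eta function: $\eta(s)=\sum_{n=1}^\infty\frac{(-1)^{n-1}}{n^s}$ (limit of partial sums); 2. for every $s\in\mathbb{C}$, $$\eta(s)=\sum_{n=0}^\infty\Big[\sum_{k=0}^n P_k(n)\,\eta(k)\Big]P_n(s);$$ 3. for every $s\in\mathbb{C}$ with $2^{1-s}\neq1$, $$\zeta(s)=\sum_{n=0}^\infty\Big[\sum_{k=0}^n P_k(n)\,\frac{1-2^{1-k}}{1-2^{1-s}}\,\zeta(k)\Big]P_n(s),$$ where for $k=1$ the product $(1-2^{1-k})\zeta(k)$ stands for its limit $\eta(1)=\log 2$. The series in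 2 and 3 converge absolutely. -/

import Mathlib

open Filter Topology

noncomputable section

/-- The `n`-th Pochhammer-Newton polynomial
`P_n(α) = ((-1)^n / n!) * α (α - 1) ⋯ (α - n + 1)`. -/
def pochhammerNewton (n : ℕ) (α : ℂ) : ℂ :=
  (-1) ^ n / (n.factorial : ℂ) * ∏ m ∈ Finset.range n, (α - (m : ℂ))

/-- The (entire) function `η(s) = (1 - 2^(1-s)) ζ(s)`; at `s = 1`, where `ζ` has its pole and the
factor `1 - 2^(1-s)` its zero, the product is given its limit `log 2`. -/
def dirichletEta (s : ℂ) : ℂ :=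
  if s = 1 then (Real.log 2 : ℂ) else (1 - (2 : ℂ) ^ (1 - s)) * riemannZeta s

/-- The value `log 2` at `s = 1` is the limit of `(1 - 2^(1-s)) ζ(s)` as `s → 1`. -/
theorem tendsto_dirichletEta_one :
    Tendsto (fun s : ℂ => (1 - (2 : ℂ) ^ (1 - s)) * riemannZeta s) (𝓝[≠] 1)
      (𝓝 (dirichletEta 1)) := by
  have h1 : HasDerivAt (fun s : ℂ => 1 - (2 : ℂ) ^ (1 - s)) (Complex.log 2) 1 := by
    have h := (((hasDerivAt_id (1 : ℂ)).const_sub 1).const_cpow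
      (c := (2 : ℂ)) (Or.inl two_ne_zero)).const_sub 1
    simpa using h
  have h2 := (hasDerivAt_iff_tendsto_slope.mp h1).mul riemannZeta_residue_one
  have h3 : dirichletEta 1 = Complex.log 2 * 1 := by
    simp [dirichletEta]
  rw [h3]
  refine h2.congr' ?_
  filter_upwards [self_mem_nhdsWithin] with s hs
  have hs' : s - 1 ≠ 0 := sub_ne_zero.mpr hs
  simp only [slope_def_field, sub_self, Complex.cpow_zero, sub_zero]
  field_simp

end

noncomputable section

open fwdDiff

/-! By the binomial theorem, `∑ k, P_k(n) (m+1)^(-k) = (m/(m+1))^n`, so the `n`-th coefficient is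
formally the alternating sum of `(m/(m+1))^n` over `m`. That series diverges, since its terms do not
tend to zero; its Euler transform converges and is `newtonCoeff n`.

The coefficients decay faster than every power of `n` (`exists_norm_newtonCoeff_le`), while `P_n(s)`
grows at most polynomially, locally uniformly in `s`. Hence the Newton series converges absolutely
to an entire function.

For `Re s > 0`, the binomial series of `(1-x)^s` at `x = m/(m+1)` and an exchange of sums identify
that function with the Euler transform of `∑ (-1)^m (m+1)^(-s)` (`newtonSeries_eq_eulerSum`). For
`Re s > 1` this is `η(s)`, and the identity theorem gives equality everywhere. -/

/-! ### Euler transform of alternating series -/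

/-- The Euler transform `(f 0 - ∑ (-1)^m (Δ f) m) / 2` of the alternating series `∑ (-1)^m f m`;
it has the same sum whenever the latter converges. -/
def eulerSum (f : ℕ → ℂ) : ℂ :=
  (f 0 - ∑' m, (-1 : ℂ) ^ m * Δ_[1] f m) / 2

theorem Summable.fwdDiff_one {u : ℕ → ℂ} (hu : Summable u) : Summable (Δ_[1] u) :=
  ((summable_nat_add_iff 1).2 hu).sub hu

theorem Summable.tsum_alternating_eq_eulerSum {u : ℕ → ℂ} (hu : Summable u) :
    ∑' m, (-1 : ℂ) ^ m * u m = eulerSum u := by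
  have h1 : Summable fun m => (-1 : ℂ) ^ m * u (m + 1) :=
    ((summable_nat_add_iff 1).2 hu).alternating
  have h2 : ∑' m, (-1 : ℂ) ^ m * Δ_[1] u m
      = ∑' m, (-1 : ℂ) ^ m * u (m + 1) - ∑' m, (-1 : ℂ) ^ m * u m := by
    rw [← h1.tsum_sub hu.alternating]
    exact tsum_congr fun m => by simp [fwdDiff, mul_sub]
  have h3 : ∑' m, (-1 : ℂ) ^ m * u m = u 0 - ∑' m, (-1 : ℂ) ^ m * u (m + 1) := by
    rw [hu.alternating.tsum_eq_zero_add, sub_eq_add_neg, ← tsum_neg]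
    simp [pow_succ]
  rw [eulerSum, h2]
  linear_combination (1 / 2 : ℂ) * h3

theorem norm_tsum_alternating_le {u : ℕ → ℂ} (hu : Summable u) :
    ‖∑' m, (-1 : ℂ) ^ m * u m‖ ≤ ∑' m, ‖u m‖ := by
  simpa using norm_tsum_le_tsum_norm hu.alternating.norm

theorem norm_eulerSum_le_add {f : ℕ → ℂ} :
    ‖eulerSum f‖ ≤ ‖f 0‖ + ‖∑' m, (-1 : ℂ) ^ m * Δ_[1] f m‖ := by
  rw [eulerSum, norm_div, Complex.norm_ofNat]
  have := norm_sub_le (f 0) (∑' m, (-1 : ℂ) ^ m * Δ_[1] f m)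
  linarith [norm_nonneg (f 0 - ∑' m, (-1 : ℂ) ^ m * Δ_[1] f m)]

/-- Once the differences are summable, the transform can be repeated: each round costs one boundary
term at `0` and raises the order of the difference. The factors `1/2` are discarded. -/
theorem norm_eulerSum_le (r : ℕ) {f : ℕ → ℂ} (hf : Summable (Δ_[1] f)) :
    ‖eulerSum f‖ ≤ ∑ j ∈ Finset.range (r + 1), ‖(fwdDiff 1)^[j] f 0‖ + ∑' m, ‖(fwdDiff 1)^[r + 1] f m‖ := by
  induction r generalizing f with
  | zero =>
    simpa using norm_eulerSum_le_add.trans (add_le_add_right (norm_tsum_alternating_le hf) _)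
  | succ r ih =>
    refine norm_eulerSum_le_add.trans ?_
    rw [hf.tsum_alternating_eq_eulerSum, Finset.sum_range_succ']
    have := ih hf.fwdDiff_one
    simp only [Function.iterate_succ_apply, Function.iterate_zero, id] at this ⊢
    linarith

/-! ### Bounds for iterated differences -/

theorem exists_norm_fwdDiff_iter_le_of_re_pos (r : ℕ) : ∃ C : ℝ, 0 ≤ C ∧ ∀ g : ℂ → ℂ,
    DifferentiableOn ℂ g {z | 0 < z.re} → (∀ z : ℂ, 0 < z.re → ‖g z‖ ≤ 1) →
    DifferentiableOn ℂ ((fwdDiff 1)^[r] g) {z | 0 < z.re} ∧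
      ∀ z : ℂ, 0 < z.re → ‖(fwdDiff 1)^[r] g z‖ ≤ C / z.re ^ r := by
  induction r with
  | zero => exact ⟨1, zero_le_one, fun g hg hb => ⟨hg, by simpa using hb⟩⟩
  | succ r ih =>
    obtain ⟨C, hC, ih⟩ := ih
    refine ⟨C * 2 ^ (r + 1), by positivity, fun g hg hb => ?_⟩
    obtain ⟨hd, hle⟩ := ih g hg hb
    rw [Function.iterate_succ_apply']
    set G := (fwdDiff 1)^[r] g
    have hopen : IsOpen {z : ℂ | 0 < z.re} := isOpen_lt continuous_const Complex.continuous_re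
    refine ⟨?_, fun z hz => ?_⟩
    · refine DifferentiableOn.sub ?_ hd
      refine hd.comp (by fun_prop) fun z hz => ?_
      have : 0 < z.re := hz
      simp only [Set.mem_ofPred_eq, Complex.add_re, Complex.one_re]
      linarith
    -- Cauchy's estimate on the disc of radius `z.re / 2`, which stays in the half-plane: each
    -- difference gains a factor `1 / z.re`.
    · have hderiv : ∀ w ∈ {w : ℂ | z.re ≤ w.re}, ‖deriv G w‖ ≤ C * 2 ^ (r + 1) / z.re ^ (r + 1) := by
        intro w hw
        have hw' : z.re ≤ w.re := hw
        have hball : ∀ v ∈ Metric.closedBall w (z.re / 2), z.re / 2 ≤ v.re := by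
          intro v hv
          have h1 := (Complex.abs_re_le_norm (v - w)).trans (mem_closedBall_iff_norm.1 hv)
          rw [Complex.sub_re] at h1
          have := (abs_le.1 h1).1
          linarith
        have h := Complex.norm_deriv_le_of_forall_mem_sphere_norm_le (f := G) (c := w)
          (C := C / (z.re / 2) ^ r) (half_pos hz) ?_ ?_
        · refine h.trans_eq ?_
          rw [div_div, ← pow_succ, div_pow, div_div_eq_mul_div]
        · apply DifferentiableOn.diffContOnCl
          rw [closure_ball _ (half_pos hz).ne']
          exact hd.mono fun v hv => lt_of_lt_of_le (half_pos hz) (hball v hv)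
        · intro v hv
          have hv' := hball v (Metric.sphere_subset_closedBall hv)
          refine (hle v (lt_of_lt_of_le (half_pos hz) hv')).trans ?_
          have := half_pos hz
          gcongr
      have h := Convex.norm_image_sub_le_of_norm_deriv_le (f := G) (s := {w : ℂ | z.re ≤ w.re})
        (fun w hw => hd.differentiableAt (hopen.mem_nhds (lt_of_lt_of_le hz hw))) hderiv
        (convex_halfSpace_re_ge z.re) (x := z) (y := z + 1) (by simp) (by simp)
      simpa [fwdDiff] using h

theorem fwdDiff_iter_comp_natCast_add {f : ℕ → ℂ} {g : ℂ → ℂ} {c : ℂ}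
    (h : ∀ m : ℕ, f m = g (m + c)) (r m : ℕ) : (fwdDiff 1)^[r] f m = (fwdDiff 1)^[r] g (m + c) := by
  induction r generalizing m with
  | zero => exact h m
  | succ r ih =>
    simp only [Function.iterate_succ_apply', fwdDiff, ih]
    push_cast
    ring_nf

theorem norm_fwdDiff_iter_le_of_monotone {f : ℕ → ℂ} {F : ℕ → ℝ} (hF : Monotone F)
    (h : ∀ m, ‖f m‖ ≤ F m) (r m : ℕ) : ‖(fwdDiff 1)^[r] f m‖ ≤ 2 ^ r * F (m + r) := by
  induction r generalizing m with
  | zero => simpa using h m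
  | succ r ih =>
    simp only [Function.iterate_succ_apply', fwdDiff]
    have h1 := ih (m + 1)
    have h2 := ih m
    have h3 : F (m + r) ≤ F (m + (r + 1)) := hF (by omega)
    rw [show m + 1 + r = m + (r + 1) by omega] at h1
    have h4 : (2 : ℝ) ^ r * F (m + r) ≤ 2 ^ r * F (m + (r + 1)) := by gcongr
    refine (norm_sub_le _ _).trans ?_
    rw [pow_succ]
    linarith

/-! ### The sequences `(m/(m+1))^n` and their differences -/

/-- The sequence `m ↦ (m / (m + 1)) ^ n`. -/
def ratioPow (n m : ℕ) : ℝ := ((m : ℝ) / (m + 1)) ^ n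

theorem ratioPow_nonneg (n m : ℕ) : 0 ≤ ratioPow n m := by
  unfold ratioPow; positivity

theorem ratioPow_mono (n : ℕ) : Monotone (ratioPow n) := by
  refine monotone_nat_of_le_succ fun m => ?_
  unfold ratioPow
  gcongr ?_ ^ n
  rw [div_le_div_iff₀ (by positivity) (by positivity)]
  push_cast
  nlinarith

/-- Combine `m/(m+1) ≤ exp(-1/(m+1))` with `exp(-x) ≤ p!/x^p`. -/
theorem ratioPow_le {n : ℕ} (hn : n ≠ 0) (p m : ℕ) :
    ratioPow n m ≤ p.factorial * (((m : ℝ) + 1) / n) ^ p := by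
  have hn' : (0 : ℝ) < n := by positivity
  have hm : (0 : ℝ) < m + 1 := by positivity
  have h1 : (m : ℝ) / (m + 1) ≤ Real.exp (-(1 / (m + 1))) := by
    have := Real.add_one_le_exp (-(1 / ((m : ℝ) + 1)))
    refine le_trans (le_of_eq ?_) this
    field_simp
    ring
  have h2 : ratioPow n m ≤ Real.exp (-(n / (m + 1))) := by
    refine (pow_le_pow_left₀ (by positivity) h1 n).trans_eq ?_
    rw [← Real.exp_nat_mul]
    congr 1
    ring
  refine h2.trans ?_
  have h3 := Real.pow_div_factorial_le_exp ((n : ℝ) / (m + 1)) (by positivity) p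
  rw [Real.exp_neg]
  refine (inv_anti₀ (by positivity) h3).trans_eq ?_
  simp only [div_pow, inv_div]
  field_simp

theorem norm_cayley_le_one {z : ℂ} (hz : 0 < z.re) : ‖(z - 1 / 2) / (z + 1 / 2)‖ ≤ 1 := by
  rw [norm_div]
  refine div_le_one_of_le₀ ?_ (norm_nonneg _)
  rw [← sq_le_sq₀ (norm_nonneg _) (norm_nonneg _), ← Complex.normSq_eq_norm_sq,
    ← Complex.normSq_eq_norm_sq, Complex.normSq_apply, Complex.normSq_apply]
  have e : (1 / 2 : ℂ) = ((1 / 2 : ℝ) : ℂ) := by push_cast; rfl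
  rw [e]
  simp only [Complex.sub_re, Complex.add_re, Complex.sub_im, Complex.add_im, Complex.ofReal_re,
    Complex.ofReal_im]
  nlinarith

/-- With `z = m + 1/2` the ratio is the Cayley transform `(z - 1/2)/(z + 1/2)`, bounded by `1` on
the right half-plane together with its powers; hence `C` is independent of `n`. -/
theorem exists_norm_fwdDiff_iter_ratioPow_le (r : ℕ) : ∃ C : ℝ, 0 ≤ C ∧ ∀ n m : ℕ,
    ‖(fwdDiff 1)^[r] (fun m => (ratioPow n m : ℂ)) m‖ ≤ C / ((m : ℝ) + 1 / 2) ^ r := by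
  obtain ⟨C, hC, h⟩ := exists_norm_fwdDiff_iter_le_of_re_pos r
  refine ⟨C, hC, fun n m => ?_⟩
  have hne : ∀ z : ℂ, 0 < z.re → z + 1 / 2 ≠ 0 := by
    intro z hz h0
    have := congrArg Complex.re h0
    norm_num at this
    linarith
  have key := (h (fun z => ((z - 1 / 2) / (z + 1 / 2)) ^ n) ?_ ?_).2 (m + 1 / 2) ?_
  · rw [fwdDiff_iter_comp_natCast_add (c := 1 / 2)
      (g := fun z => ((z - 1 / 2) / (z + 1 / 2)) ^ n)]
    · refine key.trans_eq ?_
      norm_num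
    · intro m
      simp only [ratioPow]
      push_cast
      congr 2
      · ring
      · ring
  · intro z hz
    have := hne z hz
    exact DifferentiableAt.differentiableWithinAt (by fun_prop (disch := assumption))
  · intro z hz
    rw [norm_pow]
    exact pow_le_one₀ (norm_nonneg _) (norm_cayley_le_one hz)
  · norm_num
    positivity

theorem summable_inv_add_half_sq : Summable fun m : ℕ => 1 / ((m : ℝ) + 1 / 2) ^ 2 := by
  have h := (Real.summable_one_div_nat_add_rpow (1 / 2) 2).2 one_lt_two
  refine h.congr fun m => ?_
  rw [abs_of_nonneg (by positivity)]
  norm_num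

/-- Geometric mean of two bounds: with `x = m + 1/2`, the uniform one `x^(-(2k+4))` and the
small-`m` one `(x/n)^(2k)`. The order `2k+4` leaves a summable `x^(-2)`. -/
theorem exists_norm_fwdDiff_iter_ratioPow_le_div_pow (k : ℕ) : ∃ C : ℝ, 0 ≤ C ∧
    ∀ n m : ℕ, n ≠ 0 → ‖(fwdDiff 1)^[2 * k + 4] (fun m => (ratioPow n m : ℂ)) m‖
      ≤ C / (n : ℝ) ^ k * (1 / ((m : ℝ) + 1 / 2) ^ 2) := by
  set r := 2 * k + 4 with hr
  obtain ⟨C, hC, h⟩ := exists_norm_fwdDiff_iter_ratioPow_le r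
  set A : ℝ := 2 ^ r * ((2 * k).factorial * (2 * r + 2) ^ (2 * k)) with hA
  have hA0 : 0 ≤ A := by positivity
  refine ⟨Real.sqrt (C * A), Real.sqrt_nonneg _, fun n m hn => ?_⟩
  have hn' : (0 : ℝ) < n := by positivity
  have h1 := h n m
  have h2 := norm_fwdDiff_iter_le_of_monotone (f := fun m => (ratioPow n m : ℂ))
    (ratioPow_mono n) (fun m => by
      rw [Complex.norm_real, Real.norm_of_nonneg (ratioPow_nonneg n m)]) r m
  have h3 : 2 ^ r * ratioPow n (m + r) ≤ A * (((m : ℝ) + 1 / 2) / n) ^ (2 * k) := by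
    have h4 := ratioPow_le hn (2 * k) (m + r)
    have h5 : (((m + r : ℕ) : ℝ) + 1) / n ≤ (2 * r + 2) * (((m : ℝ) + 1 / 2) / n) := by
      rw [← mul_div_assoc]
      gcongr
      push_cast
      nlinarith [mul_nonneg (Nat.cast_nonneg (α := ℝ) m) (Nat.cast_nonneg (α := ℝ) r),
        Nat.cast_nonneg (α := ℝ) m]
    have h6 : ((((m + r : ℕ) : ℝ) + 1) / n) ^ (2 * k)
        ≤ ((2 * r + 2) * (((m : ℝ) + 1 / 2) / n)) ^ (2 * k) := by gcongr
    rw [mul_pow] at h6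
    calc _ ≤ 2 ^ r * ((2 * k).factorial *
          ((2 * r + 2) ^ (2 * k) * (((m : ℝ) + 1 / 2) / n) ^ (2 * k))) := by
          gcongr
          exact h4.trans (by gcongr)
      _ = _ := by rw [hA]; ring
  refine le_of_sq_le_sq ?_ (by positivity)
  rw [sq]
  refine (mul_le_mul h1 (h2.trans h3) (norm_nonneg _) (by positivity)).trans_eq ?_
  rw [mul_pow, div_pow (√(C * A)), Real.sq_sqrt (by positivity), hr, div_pow]
  have hx : (0 : ℝ) < m + 1 / 2 := by positivity
  generalize (m : ℝ) + 1 / 2 = x at hx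
  field_simp
  ring

/-- A monotone sequence in `[0, 1]` has total variation at most `1`. -/
theorem summable_fwdDiff_ratioPow (n : ℕ) :
    Summable (Δ_[1] fun m => (ratioPow n m : ℂ)) ∧
      ∑' m, ‖Δ_[1] (fun m => (ratioPow n m : ℂ)) m‖ ≤ 1 := by
  have hle : ∀ m, ratioPow n m ≤ 1 := fun m =>
    pow_le_one₀ (by positivity) (div_le_one_of_le₀ (by linarith) (by positivity))
  have hnorm : ∀ m, ‖Δ_[1] (fun m => (ratioPow n m : ℂ)) m‖
      = ratioPow n (m + 1) - ratioPow n m := fun m => by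
    rw [fwdDiff, ← Complex.ofReal_sub, Complex.norm_real,
      Real.norm_of_nonneg (sub_nonneg.2 (ratioPow_mono n (Nat.le_succ m)))]
  have hs : ∀ N, ∑ m ∈ Finset.range N, ‖Δ_[1] (fun m => (ratioPow n m : ℂ)) m‖ ≤ 1 := fun N => by
    simp only [hnorm]
    rw [Finset.sum_range_sub]
    linarith [hle N, ratioPow_nonneg n 0]
  exact ⟨Summable.of_norm (summable_of_sum_range_le (fun _ => norm_nonneg _) hs),
    Real.tsum_le_of_sum_range_le (fun _ => norm_nonneg _) hs⟩

/-- The coefficients of the Newton series of `dirichletEta`. -/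
def newtonCoeff (n : ℕ) : ℂ := eulerSum fun m => (ratioPow n m : ℂ)

theorem exists_norm_newtonCoeff_le (k : ℕ) :
    ∃ C : ℝ, 0 ≤ C ∧ ∀ n : ℕ, n ≠ 0 → ‖newtonCoeff n‖ ≤ C / (n : ℝ) ^ k := by
  obtain ⟨C, hC, h⟩ := exists_norm_fwdDiff_iter_ratioPow_le_div_pow k
  set B : ℝ := ∑ j ∈ Finset.range (2 * k + 4), 2 ^ j * (k.factorial * ((j : ℝ) + 1) ^ k) with hB
  refine ⟨B + C * ∑' m : ℕ, 1 / ((m : ℝ) + 1 / 2) ^ 2,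
    add_nonneg (by positivity) (mul_nonneg hC (tsum_nonneg fun m => by positivity)),
    fun n hn => ?_⟩
  refine (norm_eulerSum_le (2 * k + 3) (summable_fwdDiff_ratioPow n).1).trans ?_
  rw [add_div]
  refine add_le_add ?_ ?_
  · rw [hB, Finset.sum_div]
    refine Finset.sum_le_sum fun j _ => ?_
    have h2 := norm_fwdDiff_iter_le_of_monotone (f := fun m => (ratioPow n m : ℂ))
      (ratioPow_mono n) (fun m => by
        rw [Complex.norm_real, Real.norm_of_nonneg (ratioPow_nonneg n m)]) j 0
    refine h2.trans ?_
    rw [zero_add, mul_div_assoc, mul_div_assoc, ← div_pow]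
    gcongr
    exact ratioPow_le hn k j
  · have hsum := summable_inv_add_half_sq.mul_left (C / (n : ℝ) ^ k)
    have hle := fun m => h n m hn
    refine ((Summable.of_nonneg_of_le (fun _ => norm_nonneg _) hle hsum).tsum_le_tsum
      hle hsum).trans_eq ?_
    rw [tsum_mul_left]
    ring

/-! ### Pochhammer-Newton polynomials: binomial series and growth -/

theorem pochhammerNewton_succ (n : ℕ) (s : ℂ) :
    pochhammerNewton (n + 1) s = pochhammerNewton n s * ((n - s) / (n + 1)) := by
  have h : (n.factorial : ℂ) ≠ 0 := by exact_mod_cast n.factorial_ne_zero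
  have h' : (n : ℂ) + 1 ≠ 0 := by exact_mod_cast n.succ_ne_zero
  simp only [pochhammerNewton, Finset.prod_range_succ, Nat.factorial_succ, pow_succ]
  push_cast
  field_simp
  ring

theorem pochhammerNewton_zero (s : ℂ) : pochhammerNewton 0 s = 1 := by
  simp [pochhammerNewton]

theorem pochhammerNewton_eq_choose (n : ℕ) (s : ℂ) :
    pochhammerNewton n s = (-1) ^ n * Ring.choose s n := by
  have h : (descPochhammer ℤ n).smeval s = ∏ m ∈ Finset.range n, (s - (m : ℂ)) := by
    rw [← descPochhammer_eval_eq_prod_range, ← Polynomial.aeval_eq_smeval,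
      ← Polynomial.eval_map_algebraMap, descPochhammer_map]
  rw [Ring.choose_eq_smul, h, pochhammerNewton, smul_eq_mul]
  ring

theorem pochhammerNewton_natCast (k n : ℕ) :
    pochhammerNewton k (n : ℂ) = (-1) ^ k * (n.choose k : ℂ) := by
  rw [pochhammerNewton_eq_choose, Ring.choose_natCast]

theorem hasSum_pochhammerNewton_mul_pow (s : ℂ) {x : ℂ} (hx : ‖x‖ < 1) :
    HasSum (fun n => pochhammerNewton n s * x ^ n) ((1 - x) ^ s) := by
  have h := (Complex.one_add_cpow_hasFPowerSeriesOnBall_zero (a := s)).hasSum (y := -x)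
    (by rw [← ENNReal.ofReal_one, Metric.eball_ofReal]; simpa using hx)
  simp only [binomialSeries_apply, List.ofFn_const, List.prod_replicate, smul_eq_mul, zero_add] at h
  rw [← sub_eq_add_neg] at h
  refine h.congr_fun fun n => ?_
  rw [pochhammerNewton_eq_choose, neg_pow]
  ring

theorem differentiable_pochhammerNewton (n : ℕ) : Differentiable ℂ (pochhammerNewton n) := by
  unfold pochhammerNewton
  fun_prop

theorem norm_pochhammerNewton_le {s : ℂ} {R : ℕ} (hs : ‖s‖ ≤ R) (n : ℕ) :
    ‖pochhammerNewton n s‖ ≤ ((n : ℝ) + 1) ^ R := by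
  induction n with
  | zero => simp [pochhammerNewton_zero]
  | succ n ih =>
    have hn : (0 : ℝ) < n + 1 := by positivity
    have h1 : ‖((n : ℂ) - s) / (n + 1)‖ ≤ (1 + 1 / ((n : ℝ) + 1)) ^ R := by
      -- Bernoulli's inequality; the resulting factors telescope to `(n+2)^R`.
      refine le_trans ?_ (one_add_mul_le_pow (by linarith [div_pos one_pos hn]) R)
      have h2 : ‖(n : ℂ) + 1‖ = (n : ℝ) + 1 := by
        rw [← Nat.cast_add_one, Complex.norm_natCast, Nat.cast_add_one]
      rw [norm_div, h2, div_le_iff₀ hn]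
      refine (norm_sub_le _ _).trans ?_
      rw [Complex.norm_natCast]
      field_simp
      linarith
    rw [pochhammerNewton_succ, norm_mul]
    refine (mul_le_mul ih h1 (norm_nonneg _) (by positivity)).trans_eq ?_
    rw [← mul_pow]
    congr 1
    push_cast
    field_simp

theorem pochhammerNewton_succ_eq_GammaSeq {s : ℂ} (hs : ∀ m : ℕ, s ≠ m) {n : ℕ} (hn : n ≠ 0) :
    pochhammerNewton (n + 1) s
      = (n : ℂ) ^ (-s) / (n + 1) * (Complex.GammaSeq (-s) n)⁻¹ := by
  have h1 : ∏ j ∈ Finset.range (n + 1), (-s + (j : ℂ)) ≠ 0 := by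
    refine Finset.prod_ne_zero_iff.2 fun j _ h => hs j ?_
    linear_combination -h
  have h2 : ∏ j ∈ Finset.range (n + 1), (-s + (j : ℂ))
      = (-1) ^ (n + 1) * ∏ j ∈ Finset.range (n + 1), (s - (j : ℂ)) := by
    have h := Finset.prod_neg (s := Finset.range (n + 1)) fun j : ℕ => s - (j : ℂ)
    rw [Finset.card_range] at h
    rw [← h]
    exact Finset.prod_congr rfl fun j _ => by ring
  have h3 : (n : ℂ) ^ (-s) ≠ 0 := by
    simp [Complex.cpow_eq_zero_iff, hn]
  have h4 : (n.factorial : ℂ) ≠ 0 := by exact_mod_cast n.factorial_ne_zero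
  have h' : (n : ℂ) + 1 ≠ 0 := by exact_mod_cast n.succ_ne_zero
  rw [pochhammerNewton, Complex.GammaSeq, div_mul_eq_mul_div, ← h2, Nat.factorial_succ]
  push_cast
  field_simp

/-- At natural `s` the sequence terminates; otherwise Euler's limit for `Γ(-s)` gives size `n^(-Re s
- 1)`. -/
theorem summable_norm_pochhammerNewton {s : ℂ} (hs : 0 < s.re) :
    Summable fun n => ‖pochhammerNewton n s‖ := by
  by_cases hN : ∃ N : ℕ, s = N
  · obtain ⟨N, rfl⟩ := hN
    refine summable_of_ne_finset_zero (s := Finset.range (N + 1)) fun n hn => ?_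
    rw [pochhammerNewton_natCast, Nat.choose_eq_zero_of_lt (by simpa using hn)]
    simp
  · push Not at hN
    have hΓ : Complex.Gamma (-s) ≠ 0 := Complex.Gamma_ne_zero fun m h => hN m (neg_injective h)
    have hb := ((Complex.GammaSeq_tendsto_Gamma (-s)).inv₀ hΓ).isBigO_one ℝ
    rw [← summable_nat_add_iff 1]
    refine summable_of_isBigO_nat (Real.summable_nat_rpow.2 (by linarith : -s.re - 1 < -1)) ?_
    have h1 : (fun n : ℕ => (n : ℂ) ^ (-s) / (n + 1)) =O[atTop]
        fun n : ℕ => (n : ℝ) ^ (-s.re - 1) := by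
      refine Asymptotics.IsBigO.of_bound 1 ?_
      filter_upwards [eventually_ne_atTop 0] with n hn
      have hn' : (0 : ℝ) < n := by positivity
      have h2 : ‖(n : ℂ) + 1‖ = (n : ℝ) + 1 := by
        rw [← Nat.cast_add_one, Complex.norm_natCast, Nat.cast_add_one]
      rw [norm_div, h2, Complex.norm_natCast_cpow_of_pos (Nat.pos_of_ne_zero hn), one_mul,
        Real.norm_of_nonneg (by positivity), Real.rpow_sub_one hn'.ne', Complex.neg_re]
      gcongr
      linarith
    refine (((h1.mul hb).norm_left).congr' ?_ ?_)
    · filter_upwards [eventually_ne_atTop 0] with n hn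
      rw [pochhammerNewton_succ_eq_GammaSeq hN hn]
    · exact Eventually.of_forall fun n => mul_one _

/-! ### The Newton series as an entire function and as an Euler transform -/

theorem summable_norm_newtonCoeff_mul_pow (R : ℕ) :
    Summable fun n : ℕ => ‖newtonCoeff n‖ * ((n : ℝ) + 1) ^ R := by
  obtain ⟨C, hC, h⟩ := exists_norm_newtonCoeff_le (R + 2)
  refine summable_of_isBigO_nat (Real.summable_one_div_nat_pow.2 one_lt_two) ?_
  refine Asymptotics.IsBigO.of_bound (C * 2 ^ R) ?_
  filter_upwards [eventually_ne_atTop 0] with n hn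
  have hn' : (0 : ℝ) < n := by positivity
  have hn1 : (1 : ℝ) ≤ n := by exact_mod_cast Nat.one_le_iff_ne_zero.2 hn
  rw [Real.norm_of_nonneg (by positivity), Real.norm_of_nonneg (by positivity)]
  calc ‖newtonCoeff n‖ * ((n : ℝ) + 1) ^ R
      ≤ C / (n : ℝ) ^ (R + 2) * (2 * n) ^ R := by
        gcongr
        · exact h n hn
        · linarith
    _ = _ := by
        rw [mul_pow, pow_add]
        field_simp

theorem summable_newtonCoeff_mul_pochhammerNewton (s : ℂ) :
    Summable fun n => newtonCoeff n * pochhammerNewton n s := by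
  obtain ⟨R, hR⟩ := exists_nat_ge ‖s‖
  refine Summable.of_norm_bounded (summable_norm_newtonCoeff_mul_pow R) fun n => ?_
  rw [norm_mul]
  gcongr
  exact norm_pochhammerNewton_le hR n

theorem differentiable_tsum_newtonCoeff :
    Differentiable ℂ fun s => ∑' n, newtonCoeff n * pochhammerNewton n s := by
  intro s
  obtain ⟨R, hR⟩ := exists_nat_gt ‖s‖
  refine (Complex.differentiableOn_tsum_of_summable_norm (U := Metric.ball 0 R)
    (summable_norm_newtonCoeff_mul_pow R)
    (fun n => ((differentiable_pochhammerNewton n).const_mul _).differentiableOn)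
    Metric.isOpen_ball fun n w hw => ?_).differentiableAt
    (Metric.isOpen_ball.mem_nhds (by simpa using hR))
  rw [norm_mul]
  gcongr
  exact norm_pochhammerNewton_le (by simpa using (mem_ball_zero_iff.1 hw).le) n

theorem hasSum_pochhammerNewton_mul_ratioPow (s : ℂ) (m : ℕ) :
    HasSum (fun n => pochhammerNewton n s * (ratioPow n m : ℂ)) (1 / ((m : ℂ) + 1) ^ s) := by
  have hm : (0 : ℝ) < m + 1 := by positivity
  have hm' : (m : ℂ) + 1 ≠ 0 := by exact_mod_cast m.succ_ne_zero
  have hx : ‖(((m : ℝ) / (m + 1) : ℝ) : ℂ)‖ < 1 := by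
    rw [Complex.norm_real, Real.norm_of_nonneg (by positivity), div_lt_one hm]
    linarith
  have h := hasSum_pochhammerNewton_mul_pow s hx
  have h1 : (1 : ℂ) - (((m : ℝ) / (m + 1) : ℝ) : ℂ) = (((m : ℝ) + 1 : ℝ) : ℂ)⁻¹ := by
    push_cast
    field_simp
    ring
  rw [h1, Complex.inv_cpow_ofReal_nonneg hm.le, ← one_div] at h
  simpa [ratioPow] using h

theorem newtonSeries_eq_eulerSum {s : ℂ} (hs : 0 < s.re) :
    Summable (Δ_[1] fun m : ℕ => 1 / ((m : ℂ) + 1) ^ s) ∧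
    HasSum (fun n => newtonCoeff n * pochhammerNewton n s)
      (eulerSum fun m : ℕ => 1 / ((m : ℂ) + 1) ^ s) := by
  obtain ⟨G, hG⟩ : ∃ G : ℕ × ℕ → ℂ, ∀ n m, G (n, m) = pochhammerNewton n s *
      ((-1) ^ m * Δ_[1] (fun m => (ratioPow n m : ℂ)) m) :=
    ⟨fun p => pochhammerNewton p.1 s *
      ((-1) ^ p.2 * Δ_[1] (fun m => (ratioPow p.1 m : ℂ)) p.2), fun _ _ => rfl⟩
  have hG_norm : ∀ n m, ‖G (n, m)‖
      = ‖pochhammerNewton n s‖ * ‖Δ_[1] (fun m => (ratioPow n m : ℂ)) m‖ := by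
    simp [hG]
  -- Fubini applies: the total variation in `m` is at most `1`, and `P_n(s)` is absolutely summable
  -- in `n`.
  have hGs : Summable G := by
    refine Summable.of_norm ((summable_prod_of_nonneg fun _ => norm_nonneg _).2 ⟨fun n => ?_, ?_⟩)
    · simp only [hG_norm]
      exact (summable_fwdDiff_ratioPow n).1.norm.mul_left _
    · simp only [hG_norm, tsum_mul_left]
      refine Summable.of_nonneg_of_le (fun n => by positivity) (fun n => ?_)
        (summable_norm_pochhammerNewton hs)
      exact mul_le_of_le_one_right (norm_nonneg _) (summable_fwdDiff_ratioPow n).2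
  have hcol : ∀ m, HasSum (fun n => G (n, m))
      ((-1) ^ m * Δ_[1] (fun m : ℕ => 1 / ((m : ℂ) + 1) ^ s) m) := by
    intro m
    refine (((hasSum_pochhammerNewton_mul_ratioPow s (m + 1)).sub
      (hasSum_pochhammerNewton_mul_ratioPow s m)).mul_left ((-1) ^ m)).congr_fun fun n => ?_
    simp only [hG, fwdDiff]
    ring
  have hrow : ∀ n, HasSum (fun m => G (n, m)) (pochhammerNewton n s *
      ∑' m, (-1) ^ m * Δ_[1] (fun m => (ratioPow n m : ℂ)) m) := fun n => by
    simp only [hG]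
    exact (summable_fwdDiff_ratioPow n).1.alternating.hasSum.mul_left _
  have h1 := hGs.hasSum.prod_fiberwise hrow
  have h2 := ((Equiv.prodComm ℕ ℕ).hasSum_iff.2 hGs.hasSum).prod_fiberwise hcol
  refine ⟨?_, ?_⟩
  · refine h2.summable.alternating.congr fun m => ?_
    rw [← mul_assoc, ← mul_pow]
    simp
  · rw [eulerSum, h2.tsum_eq]
    refine (((hasSum_pochhammerNewton_mul_ratioPow s 0).sub h1).div_const 2).congr_fun fun n => ?_
    simp only [newtonCoeff, eulerSum]
    ring

theorem sum_range_alternating_eq (f : ℕ → ℂ) (N : ℕ) :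
    ∑ m ∈ Finset.range N, (-1 : ℂ) ^ m * f m
      = (f 0 - ∑ m ∈ Finset.range N, (-1 : ℂ) ^ m * Δ_[1] f m - (-1) ^ N * f N) / 2 := by
  induction N with
  | zero => simp
  | succ N ih =>
    rw [Finset.sum_range_succ, ih, Finset.sum_range_succ, fwdDiff, pow_succ]
    ring

/-- Summation by parts leaves the boundary term `(-1)^N f N / 2`, which `h0` removes. -/
theorem tendsto_sum_alternating_eulerSum {f : ℕ → ℂ} (hf : Summable (Δ_[1] f))
    (h0 : Tendsto f atTop (𝓝 0)) :
    Tendsto (fun N => ∑ m ∈ Finset.range N, (-1 : ℂ) ^ m * f m) atTop (𝓝 (eulerSum f)) := by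
  have h1 : Tendsto (fun N : ℕ => (-1 : ℂ) ^ N * f N) atTop (𝓝 0) := by
    rw [tendsto_zero_iff_norm_tendsto_zero] at h0 ⊢
    simpa using h0
  have h2 := ((hf.alternating.hasSum.tendsto_sum_nat.const_sub (f 0)).sub h1).div_const 2
  rw [sub_zero] at h2
  exact h2.congr fun N => (sum_range_alternating_eq f N).symm

theorem eulerSum_sum_mul (S : Finset ℕ) (c : ℕ → ℂ) (f : ℕ → ℕ → ℂ)
    (hf : ∀ k ∈ S, Summable (Δ_[1] (f k))) :
    eulerSum (fun m => ∑ k ∈ S, c k * f k m) = ∑ k ∈ S, c k * eulerSum (f k) := by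
  have h : ∑' m, (-1 : ℂ) ^ m * Δ_[1] (fun m => ∑ k ∈ S, c k * f k m) m
      = ∑ k ∈ S, c k * ∑' m, (-1 : ℂ) ^ m * Δ_[1] (f k) m := by
    simp only [← tsum_mul_left]
    rw [← Summable.tsum_finsetSum fun k hk => (hf k hk).alternating.mul_left _]
    refine tsum_congr fun m => ?_
    rw [fwdDiff, ← Finset.sum_sub_distrib, Finset.mul_sum]
    exact Finset.sum_congr rfl fun k _ => by rw [fwdDiff]; ring
  simp only [eulerSum]
  rw [h, ← Finset.sum_sub_distrib, Finset.sum_div]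
  exact Finset.sum_congr rfl fun k _ => by ring

/-! ### Identification with `η` and its values at the naturals -/

theorem tsum_alternating_of_odd_eq_mul {u : ℕ → ℂ} {c : ℂ} (hu : Summable u)
    (hodd : ∀ k, u (2 * k + 1) = c * u k) :
    ∑' m, (-1 : ℂ) ^ m * u m = (1 - 2 * c) * ∑' m, u m := by
  have he : Summable fun k => u (2 * k) := hu.comp_injective (mul_right_injective₀ two_ne_zero)
  have ho : Summable fun k => u (2 * k + 1) := by
    simp only [hodd]
    exact hu.mul_left _
  have h1 := tsum_even_add_odd he ho
  have h2 := tsum_even_add_odd (f := fun m : ℕ => (-1 : ℂ) ^ m * u m)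
    (by simpa [pow_mul] using he) (by simpa [pow_succ, pow_mul] using ho.neg)
  simp only [pow_add, pow_one, pow_mul, neg_one_sq, one_pow, one_mul, neg_mul, tsum_neg] at h2
  simp only [hodd, tsum_mul_left] at h1 h2
  linear_combination h1 - h2

theorem one_div_two_mul_cpow (k : ℕ) (s : ℂ) :
    1 / (((2 * k + 1 : ℕ) : ℂ) + 1) ^ s = (2 : ℂ) ^ (-s) * (1 / ((k : ℂ) + 1) ^ s) := by
  have h := Complex.natCast_mul_natCast_cpow 2 (k + 1) s
  have e : ((2 * k + 1 : ℕ) : ℂ) + 1 = ((2 : ℕ) : ℂ) * ((k + 1 : ℕ) : ℂ) := by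
    push_cast
    ring
  rw [e, h, Complex.cpow_neg, one_div, mul_inv, one_div, Nat.cast_ofNat, Nat.cast_add_one k]

theorem dirichletEta_eq_eulerSum_of_one_lt_re {s : ℂ} (hs : 1 < s.re) :
    dirichletEta s = eulerSum fun m : ℕ => 1 / ((m : ℂ) + 1) ^ s := by
  have hs1 : s ≠ 1 := by
    intro h
    rw [h, Complex.one_re] at hs
    exact lt_irrefl _ hs
  have hu : Summable fun m : ℕ => 1 / ((m : ℂ) + 1) ^ s := by
    simpa using (summable_nat_add_iff 1).2 (Complex.summable_one_div_nat_cpow.2 hs)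
  rw [← hu.tsum_alternating_eq_eulerSum,
    tsum_alternating_of_odd_eq_mul hu fun k => one_div_two_mul_cpow k s,
    ← zeta_eq_tsum_one_div_nat_add_one_cpow hs, dirichletEta, if_neg hs1,
    sub_eq_add_neg 1 s, Complex.cpow_add _ _ two_ne_zero, Complex.cpow_one]

theorem differentiable_dirichletEta : Differentiable ℂ dirichletEta := by
  have h : ∀ s : ℂ, s ≠ 1 → DifferentiableAt ℂ dirichletEta s := by
    intro s hs
    have h1 : DifferentiableAt ℂ (fun s : ℂ => (1 - (2 : ℂ) ^ (1 - s)) * riemannZeta s) s :=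
      ((differentiableAt_const _).sub (((differentiableAt_const _).sub
        differentiableAt_id).const_cpow (Or.inl two_ne_zero))).mul
        (differentiableAt_riemannZeta hs)
    refine h1.congr_of_eventuallyEq ?_
    filter_upwards [isOpen_ne.mem_nhds hs] with w hw
    exact if_neg hw
  intro s
  rcases eq_or_ne s 1 with rfl | hs
  · refine (Complex.analyticAt_of_differentiable_on_punctured_nhds_of_continuousAt
      ?_ ?_).differentiableAt
    · filter_upwards [self_mem_nhdsWithin] with w hw using h w hw
    · rw [continuousAt_iff_punctured_nhds]
      refine tendsto_dirichletEta_one.congr' ?_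
      filter_upwards [self_mem_nhdsWithin] with w hw
      exact (if_neg hw).symm
  · exact h s hs

theorem tsum_newtonCoeff_mul_pochhammerNewton (s : ℂ) :
    ∑' n, newtonCoeff n * pochhammerNewton n s = dirichletEta s := by
  have h := AnalyticOnNhd.eq_of_eventuallyEq (𝕜 := ℂ) (z₀ := 2)
    (differentiable_tsum_newtonCoeff.differentiableOn.analyticOnNhd isOpen_univ)
    (differentiable_dirichletEta.differentiableOn.analyticOnNhd isOpen_univ) ?_
  · exact congrFun h s
  · have hopen : IsOpen {z : ℂ | 1 < z.re} := isOpen_lt continuous_const Complex.continuous_re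
    filter_upwards [hopen.mem_nhds (show (2 : ℂ) ∈ {z : ℂ | 1 < z.re} by simp)] with z hz
    have hz' : 1 < z.re := hz
    rw [dirichletEta_eq_eulerSum_of_one_lt_re hz']
    exact (newtonSeries_eq_eulerSum (by linarith)).2.tsum_eq

/-- The Newton series carries the identity from `Re s > 1` to `Re s > 0`. -/
theorem dirichletEta_eq_eulerSum {s : ℂ} (hs : 0 < s.re) :
    dirichletEta s = eulerSum fun m : ℕ => 1 / ((m : ℂ) + 1) ^ s := by
  rw [← tsum_newtonCoeff_mul_pochhammerNewton, (newtonSeries_eq_eulerSum hs).2.tsum_eq]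

theorem dirichletEta_zero : dirichletEta 0 = 1 / 2 := by
  rw [dirichletEta, if_neg zero_ne_one, riemannZeta_zero, sub_zero, Complex.cpow_one]
  norm_num

theorem dirichletEta_natCast (k : ℕ) :
    Summable (Δ_[1] fun m : ℕ => (1 / ((m : ℂ) + 1)) ^ k) ∧
      dirichletEta k = eulerSum fun m : ℕ => (1 / ((m : ℂ) + 1)) ^ k := by
  rcases eq_or_ne k 0 with rfl | hk
  -- At `k = 0` the series is `1 - 1 + 1 - ⋯`, whose Euler transform `1/2` agrees with `η(0)`.
  · simp only [pow_zero, Nat.cast_zero, dirichletEta_zero, eulerSum, fwdDiff_const]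
    exact ⟨summable_zero, by simp⟩
  · have hk' : 0 < (k : ℂ).re := by
      rw [Complex.natCast_re]
      positivity
    have e : (fun m : ℕ => (1 / ((m : ℂ) + 1)) ^ k) = fun m : ℕ => 1 / ((m : ℂ) + 1) ^ (k : ℂ) := by
      funext m
      rw [Complex.cpow_natCast, one_div_pow]
    rw [e]
    exact ⟨(newtonSeries_eq_eulerSum hk').1, dirichletEta_eq_eulerSum hk'⟩

theorem sum_pochhammerNewton_mul_dirichletEta (n : ℕ) :
    ∑ k ∈ Finset.range (n + 1), pochhammerNewton k (n : ℂ) * dirichletEta (k : ℂ)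
      = newtonCoeff n := by
  simp only [fun k : ℕ => (dirichletEta_natCast k).2]
  rw [← eulerSum_sum_mul _ _ (fun k (m : ℕ) => (1 / ((m : ℂ) + 1)) ^ k)
    fun k _ => (dirichletEta_natCast k).1, newtonCoeff]
  congr 1
  funext m
  have hm : (m : ℂ) + 1 ≠ 0 := by exact_mod_cast m.succ_ne_zero
  have e : (ratioPow n m : ℂ) = (-(1 / ((m : ℂ) + 1)) + 1) ^ n := by
    rw [ratioPow]
    push_cast
    congr 1
    field_simp
    ring
  rw [e, add_pow]
  refine Finset.sum_congr rfl fun k _ => ?_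
  rw [pochhammerNewton_natCast, neg_pow]
  ring

theorem tendsto_one_div_nat_add_one_cpow {s : ℂ} (hs : 0 < s.re) :
    Tendsto (fun m : ℕ => 1 / ((m : ℂ) + 1) ^ s) atTop (𝓝 0) := by
  rw [tendsto_zero_iff_norm_tendsto_zero]
  have h := (tendsto_rpow_neg_atTop hs).comp
    (tendsto_natCast_atTop_atTop.comp (tendsto_add_atTop_nat 1))
  refine h.congr fun m => ?_
  simp only [Function.comp_apply]
  rw [norm_div, norm_one, ← Nat.cast_add_one, Complex.norm_natCast_cpow_of_pos m.succ_pos,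
    Real.rpow_neg (by positivity), one_div]

end

theorem theoremT :
    -- `η` is the sum of the alternating Dirichlet series wherever that series converges
    (∀ s : ℂ, 0 < s.re →
      Tendsto (fun N : ℕ => ∑ m ∈ Finset.range N, (-1 : ℂ) ^ m / ((m : ℂ) + 1) ^ s) atTop
        (𝓝 (dirichletEta s))) ∧
    -- the Newton series of `η`
    (∀ s : ℂ,
      HasSum
        (fun n : ℕ =>
          (∑ k ∈ Finset.range (n + 1), pochhammerNewton k (n : ℂ) * dirichletEta (k : ℂ)) *
            pochhammerNewton n s)
        (dirichletEta s)) ∧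
    -- the interpolation of `ζ`
    (∀ s : ℂ, (2 : ℂ) ^ (1 - s) ≠ 1 →
      HasSum
        (fun n : ℕ =>
          (∑ k ∈ Finset.range (n + 1),
            pochhammerNewton k (n : ℂ) * (dirichletEta (k : ℂ) / (1 - (2 : ℂ) ^ (1 - s)))) *
            pochhammerNewton n s)
        (riemannZeta s)) := by
  have hnewton : ∀ s : ℂ, HasSum
      (fun n : ℕ =>
        (∑ k ∈ Finset.range (n + 1), pochhammerNewton k (n : ℂ) * dirichletEta (k : ℂ)) *
          pochhammerNewton n s)
      (dirichletEta s) := by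
    intro s
    simp only [sum_pochhammerNewton_mul_dirichletEta]
    rw [← tsum_newtonCoeff_mul_pochhammerNewton]
    exact (summable_newtonCoeff_mul_pochhammerNewton s).hasSum
  refine ⟨fun s hs => ?_, hnewton, fun s hs => ?_⟩
  · rw [dirichletEta_eq_eulerSum hs]
    refine (tendsto_sum_alternating_eulerSum (newtonSeries_eq_eulerSum hs).1
      (tendsto_one_div_nat_add_one_cpow hs)).congr fun N => ?_
    exact Finset.sum_congr rfl fun m _ => by ring
  · have hs0 : 1 - (2 : ℂ) ^ (1 - s) ≠ 0 := sub_ne_zero.2 hs.symm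
    have hs1 : s ≠ 1 := by
      rintro rfl
      simp at hs
    have h := (hnewton s).div_const (1 - (2 : ℂ) ^ (1 - s))
    rw [show dirichletEta s / (1 - (2 : ℂ) ^ (1 - s)) = riemannZeta s by
      rw [dirichletEta, if_neg hs1, mul_div_cancel_left₀ _ hs0]] at h
    refine h.congr_fun fun n => ?_
    simp only [← mul_div_assoc, ← Finset.sum_div]
    ring
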